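/- Let $G$ be a finite connected simple graph, let $k,L\in\mathbb{R}$ with $0<k<L$, and let $c:V(G)\to\mathbb{R}_{\ge 0}$ be a weight function with total weight $N=\sum_{u\in V(G)}c(u)$. For a vertex $v$ of $G$, its weighted distance with respect to $c$ is \[ \sigma_c(v,G)=\sum_{w\in V(G)\setminus\{v\}}c(w)\,d_G(v,w), \] where $d_G$ is the usual graph distance, and $v$ is called a $c$-median vertex of $G$ if $\sigma_c(v,G)\le\sigma_c(u,G)$ for every vertex $u$ of $G$. Assume that $c(u)\ge k$ for every vertex $u$ of $G$, that some vertex of $G$ has weight at least $L$, and that $N-L$ is an integer multiple of $k$. If $v$ is a $c$-median vertex of $G$, then \[ \sigma_c(v,G)\le\begin{cases}\dfrac{(N-L)(N-L+k)}{2k} & \text{if } L>\dfrac N2,\\[2mm] \dfrac{N^2-2L^2}{4k}+\dfrac{N+L}{2} & \text{if } L\le\dfrac N2.\end{cases} \] -/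

import Mathlib

open scoped BigOperators

noncomputable section

/-- The weighted distance `σ_c(v) = ∑_{w ∈ V(G) - {v}} c(w) d(v, w)` of a vertex `v` of a
(finite, connected) graph `G` with respect to a weight function `c` on the vertices. -/
def SimpleGraph.weightedDistance {V : Type*} [Fintype V] [DecidableEq V]
    (G : SimpleGraph V) (c : V → ℝ) (v : V) : ℝ :=
  ∑ w ∈ Finset.univ.erase v, c w * (G.dist v w : ℝ)

/-- A vertex is a `c`-median vertex if its weighted distance is minimum among all vertices. -/
def SimpleGraph.IsMedianVertex {V : Type*} [Fintype V] [DecidableEq V]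
    (G : SimpleGraph V) (c : V → ℝ) (v : V) : Prop :=
  ∀ u : V, G.weightedDistance c v ≤ G.weightedDistance c u

end

/-! Cut the vertices other than `v` into branches of a breadth-first tree rooted at `v`. A vertex at
distance `d` has `d - 1` lower layers of its branch beneath it, each of weight at least `k`.
Weighting by `c` and summing bounds `k * (σ - S)`, with `S = N - c v`, by the products over
same-branch pairs, so `2kσ ≤ P - ∑ c² + 2kS`, where `P` sums the squared branch weights. Medianity
caps each branch at `N / 2`, hence `P ≤ S * min S (N / 2)`; the heavy vertex either makes `S` small
or makes `∑ c²` large. -/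

namespace SimpleGraph

variable {V : Type*}

/-- Every vertex other than `v` has a neighbour that is closer to `v` by one. -/
theorem Connected.exists_adj_dist_add_one_eq {G : SimpleGraph V} (hG : G.Connected) (v : V)
    {w : V} (hw : w ≠ v) : ∃ p, G.Adj p w ∧ G.dist v p + 1 = G.dist v w := by
  obtain ⟨W, hW⟩ := hG.exists_walk_length_eq_dist w v
  cases W with
  | nil => exact absurd rfl hw
  | @cons _ p _ h q =>
    refine ⟨p, h.symm, ?_⟩
    rw [Walk.length_cons, dist_comm] at hW
    have h1 : G.dist v p ≤ q.length := by
      rw [dist_comm]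
      exact dist_le q
    have h2 : G.dist v w ≤ G.dist v p + G.dist p w := hG.dist_triangle
    rw [dist_eq_one_iff_adj.2 h.symm] at h2
    omega

/-- A breadth-first search from `v` splits the other vertices into branches: `β w` is the
neighbour of `v` on the chosen geodesic to `w`, and every branch meets all the intermediate
distance layers below each of its vertices. -/
theorem Connected.exists_branch {G : SimpleGraph V} (hG : G.Connected) (v : V) :
    ∃ β : V → V, (∀ w, w ≠ v → G.dist (β w) v ≤ 1 ∧ G.dist (β w) w + 1 ≤ G.dist v w) ∧
      ∀ w i, 1 ≤ i → i < G.dist v w → ∃ w', G.dist v w' = i ∧ β w' = β w := by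
  classical
  have hex : ∀ w, ∃ p, w ≠ v → G.Adj p w ∧ G.dist v p + 1 = G.dist v w := by
    intro w
    by_cases hw : w = v
    · exact ⟨v, fun h => absurd hw h⟩
    · obtain ⟨p, hp⟩ := hG.exists_adj_dist_add_one_eq v hw
      exact ⟨p, fun _ => hp⟩
  choose π hπ using hex
  have iter : ∀ w i, i ≤ G.dist v w →
      G.dist v (π^[i] w) + i = G.dist v w ∧ G.dist (π^[i] w) w ≤ i := by
    intro w i
    induction i with
    | zero => simp
    | succ i ih =>
      intro hi
      obtain ⟨h1, h2⟩ := ih (by omega)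
      have hne : π^[i] w ≠ v := by
        intro h
        rw [h, dist_self] at h1
        omega
      obtain ⟨h3, h4⟩ := hπ _ hne
      rw [Function.iterate_succ_apply']
      have h5 : G.dist (π (π^[i] w)) w ≤ G.dist (π (π^[i] w)) (π^[i] w) + G.dist (π^[i] w) w :=
        hG.dist_triangle
      rw [dist_eq_one_iff_adj.2 h3] at h5
      omega
  -- Stopping one parent step short of `v` lands on a neighbour of `v`.
  refine ⟨fun w => π^[G.dist v w - 1] w, ?_, ?_⟩
  · intro w hw
    have hpos := hG.pos_dist_of_ne hw.symm
    obtain ⟨h1, h2⟩ := iter w (G.dist v w - 1) (by omega)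
    refine ⟨?_, ?_⟩
    · dsimp only
      rw [dist_comm]
      omega
    · dsimp only
      omega
  · intro w i hi hiw
    have h1 := (iter w (G.dist v w - i) (by omega)).1
    have h2 : G.dist v (π^[G.dist v w - i] w) = i := by omega
    refine ⟨π^[G.dist v w - i] w, h2, ?_⟩
    dsimp only
    rw [h2, ← Function.iterate_add_apply]
    congr 1
    omega

variable [Fintype V] [DecidableEq V]

theorem weightedDistance_eq_sum (G : SimpleGraph V) (c : V → ℝ) (v : V) :
    G.weightedDistance c v = ∑ w, c w * (G.dist v w : ℝ) := by
  unfold weightedDistance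
  apply Finset.sum_erase
  simp

/-- The vertices that are closer to a neighbour `u` of a median vertex `v` than to `v` carry at
most half of the total weight. -/
theorem IsMedianVertex.two_mul_sum_le {G : SimpleGraph V} (hG : G.Connected) {c : V → ℝ}
    (hc : ∀ u, 0 ≤ c u) {v : V} (hv : G.IsMedianVertex c v) {u : V} (hu : G.dist u v ≤ 1)
    (s : Finset V) (hs : ∀ w ∈ s, G.dist u w + 1 ≤ G.dist v w) :
    2 * ∑ w ∈ s, c w ≤ ∑ w, c w := by
  have h := hv u
  rw [weightedDistance_eq_sum, weightedDistance_eq_sum] at h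
  -- Moving from `v` to `u` gains at least 1 on `s` and loses at most 1 elsewhere.
  have key : ∀ w, c w * (G.dist u w : ℝ) ≤
      c w * (G.dist v w : ℝ) + c w - 2 * (if w ∈ s then c w else 0) := by
    intro w
    split_ifs with hw
    · have h1 : (G.dist u w : ℝ) + 1 ≤ G.dist v w := by exact_mod_cast hs w hw
      nlinarith [hc w]
    · have h2 : G.dist u w ≤ G.dist u v + G.dist v w := hG.dist_triangle
      have h1 : (G.dist u w : ℝ) ≤ G.dist v w + 1 := by
        have : G.dist u w ≤ G.dist v w + 1 := by omega
        exact_mod_cast this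
      nlinarith [hc w]
  have hsum := Finset.sum_le_sum fun w (_ : w ∈ Finset.univ) => key w
  rw [Finset.sum_sub_distrib, Finset.sum_add_distrib, ← Finset.mul_sum,
    Finset.sum_ite_mem, Finset.univ_inter] at hsum
  linarith

end SimpleGraph

/-- Suppose that `A` is split into classes by `β` and that below each element of height `d w`
its class has weight at least `k * (d w - 1)`. Then the moment of `d` is controlled by the class
weights and the sum of the squares of the weights. -/
theorem two_mul_sum_mul_height_le {V B : Type*} [DecidableEq V] [DecidableEq B] (A : Finset V)
    (c : V → ℝ) (d : V → ℕ) (β : V → B) (k : ℝ) (hc : ∀ u, 0 ≤ c u)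
    (h : ∀ w ∈ A, k * ((d w : ℝ) - 1) ≤ ∑ w' ∈ A with β w' = β w ∧ d w' < d w, c w') :
    2 * k * ∑ w ∈ A, c w * (d w : ℝ) ≤
      ∑ w ∈ A, c w * ∑ w' ∈ A with β w' = β w, c w' - ∑ w ∈ A, c w ^ 2
        + 2 * k * ∑ w ∈ A, c w := by
  set F : V → V → ℝ := fun w w' => if β w' = β w ∧ d w' < d w then c w * c w' else 0 with hF
  have h1 : k * ∑ w ∈ A, c w * (d w : ℝ) - k * ∑ w ∈ A, c w ≤ ∑ w ∈ A, ∑ w' ∈ A, F w w' := by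
    rw [Finset.mul_sum, Finset.mul_sum, ← Finset.sum_sub_distrib]
    refine Finset.sum_le_sum fun w hw => ?_
    have h2 := mul_le_mul_of_nonneg_left (h w hw) (hc w)
    rw [Finset.sum_filter, Finset.mul_sum] at h2
    simp only [mul_ite, mul_zero] at h2
    simp only [hF]
    linarith
  have h3 : ∑ w ∈ A, ∑ w' ∈ A, F w w' = ∑ w ∈ A, ∑ w' ∈ A, F w' w := Finset.sum_comm
  have h4 : ∑ w ∈ A, c w ^ 2 = ∑ w ∈ A, ∑ w' ∈ A, if w = w' then c w * c w' else 0 := by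
    refine Finset.sum_congr rfl fun w hw => ?_
    rw [Finset.sum_ite_eq, if_pos hw, sq]
  -- The three sums live on disjoint sets of ordered same-class pairs: `w'` lower, `w` lower, `w =
  -- w'`. Distinct pairs of equal height are dropped.
  have h5 : ∑ w ∈ A, ∑ w' ∈ A, F w w' + ∑ w ∈ A, ∑ w' ∈ A, F w' w
      + ∑ w ∈ A, (∑ w' ∈ A, if w = w' then c w * c w' else 0) ≤
      ∑ w ∈ A, c w * ∑ w' ∈ A with β w' = β w, c w' := by
    rw [← Finset.sum_add_distrib, ← Finset.sum_add_distrib]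
    refine Finset.sum_le_sum fun w _ => ?_
    rw [Finset.sum_filter, Finset.mul_sum, ← Finset.sum_add_distrib, ← Finset.sum_add_distrib]
    refine Finset.sum_le_sum fun w' _ => ?_
    have hp := mul_nonneg (hc w) (hc w')
    simp only [hF]
    by_cases hww : w = w'
    · subst hww
      simp
    · by_cases hβ : β w' = β w
      · rcases lt_trichotomy (d w) (d w') with hd | hd | hd
        · simp [hww, hβ, hd, hd.not_gt, mul_comm]
        · simp [hww, hβ, hd, hp]
        · simp [hww, hβ, hd, hd.not_gt]
      · simp [hww, hβ, Ne.symm hβ]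
  linarith

/-- If every height in `[1, d w)` is attained in the class of `w`, then the part of the class below
`w` has weight at least `k * (d w - 1)`. -/
theorem mul_height_sub_one_le_sum {V B : Type*} [DecidableEq B] (A : Finset V)
    (c : V → ℝ) (d : V → ℕ) (β : V → B) (k : ℝ) (hck : ∀ u, k ≤ c u) (hk : 0 ≤ k) (w : V)
    (hA : ∀ u, 1 ≤ d u → u ∈ A) (hw : 1 ≤ d w)
    (h : ∀ i, 1 ≤ i → i < d w → ∃ w', d w' = i ∧ β w' = β w) :
    k * ((d w : ℝ) - 1) ≤ ∑ w' ∈ A with β w' = β w ∧ d w' < d w, c w' := by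
  have hcard : d w - 1 ≤ (A.filter fun w' => β w' = β w ∧ d w' < d w).card := by
    have hsub : Finset.Ico 1 (d w) ⊆
        (A.filter fun w' => β w' = β w ∧ d w' < d w).image d := by
      intro i hi
      obtain ⟨h1, h2⟩ := Finset.mem_Ico.1 hi
      obtain ⟨w', h3, h4⟩ := h i h1 h2
      refine Finset.mem_image.2 ⟨w', Finset.mem_filter.2 ⟨hA w' ?_, h4, ?_⟩, h3⟩ <;> omega
    have := (Finset.card_le_card hsub).trans Finset.card_image_le
    rwa [Nat.card_Ico] at this
  have hle := Finset.card_nsmul_le_sum (A.filter fun w' => β w' = β w ∧ d w' < d w) c k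
    fun u _ => hck u
  rw [nsmul_eq_mul] at hle
  have hcast : (d w : ℝ) - 1 ≤ ((A.filter fun w' => β w' = β w ∧ d w' < d w).card : ℝ) := by
    rw [← Nat.cast_one, ← Nat.cast_sub hw]
    exact_mod_cast hcard
  nlinarith

theorem mainTheorem4 {V : Type*} [Fintype V] [DecidableEq V]
    (G : SimpleGraph V) (hG : G.Connected)
    (c : V → ℝ) (hc : ∀ u : V, 0 ≤ c u)
    (k L N : ℝ) (hk : 0 < k) (hkL : k < L)
    (hN : ∑ u : V, c u = N)
    (hck : ∀ u : V, k ≤ c u)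
    (hcL : ∃ u : V, L ≤ c u)
    (hmul : ∃ m : ℤ, N - L = (m : ℝ) * k)
    (v : V) (hv : G.IsMedianVertex c v) :
    G.weightedDistance c v ≤
      if L > N / 2 then (N - L) * (N - L + k) / (2 * k)
      else (N ^ 2 - 2 * L ^ 2) / (4 * k) + (N + L) / 2 := by
  obtain ⟨β, hβ, hlayer⟩ := hG.exists_branch v
  obtain ⟨x, hx⟩ := hcL
  set A := Finset.univ.erase v with hA
  have hmem : ∀ u, 1 ≤ G.dist v u → u ∈ A := by
    intro u hu
    refine Finset.mem_erase.2 ⟨?_, Finset.mem_univ u⟩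
    rintro rfl
    simp at hu
  have hpos : ∀ w ∈ A, 1 ≤ G.dist v w := fun w hw =>
    hG.pos_dist_of_ne (Finset.ne_of_mem_erase hw).symm
  have hmain := two_mul_sum_mul_height_le A c (G.dist v) β k hc fun w hw =>
    mul_height_sub_one_le_sum A c (G.dist v) β k hck hk.le w hmem (hpos w hw) (hlayer w)
  have hσ : G.weightedDistance c v = ∑ w ∈ A, c w * (G.dist v w : ℝ) := rfl
  rw [← hσ] at hmain
  set S := ∑ w ∈ A, c w with hS
  have hSN : S + c v = N := by
    rw [← hN]
    exact Finset.sum_erase_add _ _ (Finset.mem_univ v)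
  have hS0 : 0 ≤ S := Finset.sum_nonneg fun w _ => hc w
  have hbranch : ∀ w ∈ A, ∑ w' ∈ A with β w' = β w, c w' ≤ N / 2 := by
    intro w hw
    have := hv.two_mul_sum_le hG hc (hβ w (Finset.ne_of_mem_erase hw)).1
      (A.filter fun w' => β w' = β w) (by
        intro w' hw'
        obtain ⟨h1, h2⟩ := Finset.mem_filter.1 hw'
        rw [← h2]
        exact (hβ w' (Finset.ne_of_mem_erase h1)).2)
    linarith
  have hPN : ∑ w ∈ A, c w * ∑ w' ∈ A with β w' = β w, c w' ≤ S * (N / 2) := by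
    rw [hS, Finset.sum_mul]
    exact Finset.sum_le_sum fun w hw => mul_le_mul_of_nonneg_left (hbranch w hw) (hc w)
  have hPS : ∑ w ∈ A, c w * ∑ w' ∈ A with β w' = β w, c w' ≤ S * S := by
    nth_rewrite 1 [hS]
    rw [Finset.sum_mul]
    exact Finset.sum_le_sum fun w _ => mul_le_mul_of_nonneg_left
      (Finset.sum_le_sum_of_subset_of_nonneg (Finset.filter_subset _ _) fun u _ _ => hc u) (hc w)
  have hsq : ∀ B : Finset V, k * ∑ w ∈ B, c w ≤ ∑ w ∈ B, c w ^ 2 := by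
    intro B
    rw [Finset.mul_sum]
    exact Finset.sum_le_sum fun w _ => by nlinarith [hck w, hc w]
  have htwo : ∀ t : ℝ, 2 * k * G.weightedDistance c v ≤ t →
      G.weightedDistance c v ≤ t / (2 * k) := by
    intro t ht
    rw [le_div_iff₀ (by positivity)]
    linarith
  have hrhs : (N ^ 2 - 2 * L ^ 2) / (4 * k) + (N + L) / 2 =
      (N ^ 2 / 2 - L ^ 2 + k * (N + L)) / (2 * k) := by
    field_simp
    ring
  rw [hrhs]
  by_cases hxv : x = v
  · subst hxv
    have hSL : S ≤ N - L := by linarith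
    have hsqA := hsq A
    split_ifs with hL
    · apply htwo
      nlinarith
    · apply htwo
      have hNL : 0 ≤ N / 2 - L := by linarith
      nlinarith [mul_nonneg (by linarith : 0 ≤ L) hNL, mul_le_mul_of_nonneg_right hSL
        (by linarith : 0 ≤ N / 2 + k), mul_pos hk (hk.trans hkL)]
  · have hxA : x ∈ A := Finset.mem_erase.2 ⟨hxv, Finset.mem_univ x⟩
    have hxB : x ∈ A.filter fun w' => β w' = β x := Finset.mem_filter.2 ⟨hxA, rfl⟩
    have hxN : c x ≤ N / 2 :=
      (Finset.single_le_sum (f := c) (fun u _ => hc u) hxB).trans (hbranch x hxA)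
    -- A heavy vertex inside a branch forces `L ≤ c x ≤ N / 2`.
    rw [if_neg (by linarith)]
    apply htwo
    have hsqA : c x ^ 2 + k * (S - c x) ≤ ∑ w ∈ A, c w ^ 2 := by
      have h1 := hsq (A.erase x)
      have h2 := Finset.sum_erase_add A c hxA
      have h3 := Finset.sum_erase_add A (fun w => c w ^ 2) hxA
      have h4 : ∑ w ∈ A.erase x, c w = S - c x := by linarith
      rw [h4] at h1
      linarith
    -- The map `t ↦ t ^ 2 - k * t` increases for `t ≥ k / 2`, and `k < L ≤ c x`.
    have hmono : L ^ 2 - k * L ≤ c x ^ 2 - k * c x := by nlinarith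
    have hSle : S ≤ N := by linarith [hc v]
    nlinarith [mul_le_mul_of_nonneg_right hSle (by linarith : 0 ≤ N / 2 + k)]
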